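/- **Theorem (Preservation of Asymptotic Dynamics).** Let $G=(V,E,W)$ be a finite weighted directed graph with nonzero edge weights $W:E\to\mathbb{R}\setminus\{0\}$. Write $e_{ab}$ for an edge from $a$ to $b$; loops are allowed. Let $A=A(G)$ be its adjacency matrix, with $A_{ab}=W(e_{ba})$ if $e_{ba}\in E$ and $A_{ab}=0$ otherwise. Let $n=|V|$, and assume that $A\in[0,1]^{n\times n}$ is column stochastic and primitive (that is, $A$ is entrywise nonnegative and some power $A^k$, $k\ge 1$, is entrywise positive). Let $i\in V$ be a vertex with at least two outgoing edges (a loop counts as one), let $e_{ij}\in E$ with $i\ne j$, and put $w=W(e_{ij})$. The *minimal specialization* of $G$ over $i$ with edge $e_{ij}$ is the graph $\overline G=(\overline V,\overline E,\overline W)$ with $\overline V=V\cup\{\overline i\}$, where $\overline i\notin V$ is a new vertex, $$\overline E=(E\setminus\{e_{ij}\})\cup\{e_{\overline i j}\}\cup\{e_{k\overline i}\;:\;e_{ki}\in E\},$$ and, for $e_{\alpha\beta}\in\overline E$, $$\overline W(e_{\alpha\beta})=\begin{cases} 1 & \alpha=\overline i,\ \beta=j,\\ (1-w)^{-1}W(e_{i\beta})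 & \alpha=i,\ \beta\notin\{i,\overline i\},\\ (1-w)W(e_{\alpha i}) & \alpha\ne i,\ \beta=i,\\ w\,W(e_{\alpha i}) & \alpha\neq i,\ \beta=\overline i,\\ W(e_{ii}) & \alpha=\beta=i,\\ w(1-w)^{-1}W(e_{ii}) & \alpha=i,\ \beta=\overline i,\\ W(e_{\alpha\beta}) & \text{otherwise.} \end{cases}$$ Then the adjacency matrix $\overline A=A(\overline G)$ lies in $[0,1]^{(n+1)\times(n+1)}$ and is primitive and column stochastic. Consequently $\overline A$ has a unique stationary distribution $\overline{\mathbf v}$ (a nonnegative vector with entries summing to $1$ and $\overline A\,\overline{\mathbf v}=\overline{\mathbf v}$), and $$\lim_{k\to\infty}\overline A^{\,k}\mathbf x=\|\mathbf x\|_1\,\overline{\mathbf v}\qquad\text{for every }\mathbf x\in\mathbb{R}^{n+1}_{\ge 0}.$$ -/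

import Mathlib

/-- A weighted directed graph `G = (V, E, W)`: `Edge a b` says that the edge `e_{ab}` from `a` to `b`
belongs to `E`, and `weight a b` is `W(e_{ab})`. The values of `weight` off `E` play no role. -/
structure WeightedDigraph (V : Type*) where
  /-- the edge set: `Edge a b` means `e_{ab} ∈ E` -/
  Edge : V → V → Prop
  /-- the weight function: `weight a b = W(e_{ab})` when `e_{ab} ∈ E` -/
  weight : V → V → ℝ

namespace WeightedDigraph

open Classical in
/-- The adjacency matrix, `A a b = W(e_{ba})` if `e_{ba} ∈ E` and `0` otherwise
(the orientation that corresponds to multiplying column vectors from the left). -/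
noncomputable def adjMatrix {V : Type*} (G : WeightedDigraph V) : Matrix V V ℝ :=
  Matrix.of fun a b => if G.Edge b a then G.weight b a else 0

/-- The conditions under which `G` may be minimally specialized over the vertex `i` with the edge
`e_{ij}`: `i` has at least two outgoing edges, `e_{ij} ∈ E` and `i ≠ j`. -/
structure IsSpecializable {V : Type*} (G : WeightedDigraph V) (i j : V) : Prop where
  two_out : {k | G.Edge i k}.Nontrivial
  edge : G.Edge i j
  ne : i ≠ j

/-- The edges of the minimal specialization over `i` with `e_{ij}`. The vertex set is `V ∪ {i'}`,
modelled by `Option V` with `none` as the new copy `i'` of `i`: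
`(E \ {e_{ij}}) ∪ {e_{i'j}} ∪ {e_{ki'} | e_{ki} ∈ E}`. -/
def specEdge {V : Type*} (G : WeightedDigraph V) (i j : V) : Option V → Option V → Prop
  | some a, some b => G.Edge a b ∧ ¬(a = i ∧ b = j)
  | none, some b => b = j
  | some a, none => G.Edge a i
  | none, none => False

/-- The edge weights of the minimal specialization, with `w = W(e_{ij})`. Of the new vertex `none`
only the outgoing edge to `j` exists, so the value `0` below is never the weight of an edge. -/
noncomputable def specWeight {V : Type*} [DecidableEq V] (G : WeightedDigraph V) (i j : V) :
    Option V → Option V → ℝ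
  | some a, some b =>
      if a = i then
        if b = i then G.weight i i else (1 - G.weight i j)⁻¹ * G.weight i b
      else
        if b = i then (1 - G.weight i j) * G.weight a i else G.weight a b
  | some a, none =>
      if a = i then G.weight i j * (1 - G.weight i j)⁻¹ * G.weight i i
      else G.weight i j * G.weight a i
  | none, some b => if b = j then 1 else 0
  | none, none => 0

/-- The minimal specialization of `G` over the vertex `i` with the edge `e_{ij}`
(meaningful when `G.IsSpecializable i j`). -/
noncomputable def minimalSpecialization {V : Type*} [DecidableEq V] (G : WeightedDigraph V)
    (i j : V) : WeightedDigraph (Option V) where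
  Edge := G.specEdge i j
  weight := G.specWeight i j

end WeightedDigraph

/-- `v` is a stationary distribution of the (column-stochastic) matrix `M`: a probability vector
with `M v = v`. -/
structure IsStationaryDistribution {V : Type*} [Fintype V] (M : Matrix V V ℝ) (v : V → ℝ) :
    Prop where
  nonneg : ∀ a, 0 ≤ v a
  sum_eq_one : ∑ a, v a = 1
  fixed : M.mulVec v = v

/-! With w = `A j i`, a step of the chain A is a composite: split the mass at i in proportions w and
1 - w, then let the first share go to j and the second follow the other edges of i. So A = P L, with
L the `splitMatrix` and P the `outMatrix`; the specialization performs the same moves in the other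
order, giving L P. Both factors are nonnegative with column sums 1, hence so is L P. Since (L
P)^(k+1) = L A^k P, positivity of A^k passes to a power of L P. The limit holds for any primitive
stochastic matrix: some power contracts the ℓ¹ norm on vectors of sum zero. -/

namespace Matrix

section Factorization

variable {m n R : Type*} [Fintype m] [Fintype n] [DecidableEq m]

theorem mul_pow_succ_eq_mul_pow_mul [DecidableEq n] [Semiring R] (L : Matrix m n R) (P : Matrix n m R) (k : ℕ) :
    (L * P) ^ (k + 1) = L * (P * L) ^ k * P := by
  induction k with
  | zero => simp
  | succ k ih => rw [pow_succ, ih, pow_succ (P * L)]; simp only [Matrix.mul_assoc]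

/-- If `P * L` is primitive, then so is `L * P`, provided that the nonnegative matrices `L` and `P`
have no zero row and no zero column, respectively. -/
theorem IsPrimitive.mul_swap [DecidableEq n] {L : Matrix m n ℝ} {P : Matrix n m ℝ} (h : (P * L).IsPrimitive)
    (hL : ∀ a b, 0 ≤ L a b) (hP : ∀ a b, 0 ≤ P a b)
    (hL' : ∀ a, ∃ b, 0 < L a b) (hP' : ∀ b, ∃ a, 0 < P a b) : (L * P).IsPrimitive := by
  obtain ⟨-, k, -, hk⟩ := h
  refine ⟨fun a b => Finset.sum_nonneg fun c _ => mul_nonneg (hL a c) (hP c b),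
    k + 1, k.succ_pos, fun a b => ?_⟩
  rw [mul_pow_succ_eq_mul_pow_mul]
  obtain ⟨c, hc⟩ := hL' a
  obtain ⟨d, hd⟩ := hP' b
  have hpos : ∀ d, 0 < (L * (P * L) ^ k) a d := fun d =>
    Finset.sum_pos' (fun x _ => mul_nonneg (hL a x) (hk x d).le)
      ⟨c, Finset.mem_univ c, mul_pos hc (hk c d)⟩
  exact Finset.sum_pos' (fun x _ => mul_nonneg (hpos x).le (hP x b))
    ⟨d, Finset.mem_univ d, mul_pos (hpos d) hd⟩

theorem mul_mem_colStochastic_of_sum_col {L : Matrix m n ℝ} {P : Matrix n m ℝ}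
    (hL : ∀ a b, 0 ≤ L a b) (hP : ∀ a b, 0 ≤ P a b)
    (hL' : ∀ b, ∑ a, L a b = 1) (hP' : ∀ b, ∑ a, P a b = 1) : L * P ∈ colStochastic ℝ m := by
  refine mem_colStochastic_iff_sum.2
    ⟨fun a b => Finset.sum_nonneg fun c _ => mul_nonneg (hL a c) (hP c b), fun b => ?_⟩
  simp only [mul_apply]
  rw [Finset.sum_comm]
  simp [← Finset.sum_mul, hL', hP']

end Factorization

/-! ### Convergence of primitive column-stochastic chains -/

section Convergence

variable {n : Type*} [Fintype n] [DecidableEq n] {M : Matrix n n ℝ}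

theorem sum_abs_mulVec_le_of_mem_colStochastic (hM : M ∈ colStochastic ℝ n) (y : n → ℝ) :
    ∑ a, |(M *ᵥ y) a| ≤ ∑ a, |y a| := by
  calc ∑ a, |(M *ᵥ y) a| ≤ ∑ a, (M *ᵥ fun b => |y b|) a := by
        refine Finset.sum_le_sum fun a _ => ?_
        refine (Finset.abs_sum_le_sum_abs _ _).trans_eq ?_
        simp [mulVec, dotProduct, abs_mul, abs_of_nonneg (hM.1 _ _)]
    _ = ∑ a, |y a| := sum_mulVec_of_mem_colStochastic hM

/-- A column-stochastic matrix with entries at least `δ` contracts the `ℓ¹` norm on the vectors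
whose entries sum to `0`. -/
theorem sum_abs_mulVec_le_of_le (hM : M ∈ colStochastic ℝ n) {δ : ℝ} (hδ : ∀ a b, δ ≤ M a b)
    {y : n → ℝ} (hy : ∑ a, y a = 0) :
    ∑ a, |(M *ᵥ y) a| ≤ (1 - Fintype.card n * δ) * ∑ a, |y a| := by
  -- As `y` sums to zero, `δ` can be subtracted from all entries; they stay nonnegative, with column
  -- sums 1 - nδ.
  have h : ∀ a, (M *ᵥ y) a = ∑ b, (M a b - δ) * y b := fun a => by
    simp [sub_mul, Finset.sum_sub_distrib, ← Finset.mul_sum, hy, mulVec, dotProduct]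
  calc ∑ a, |(M *ᵥ y) a| ≤ ∑ a, ∑ b, (M a b - δ) * |y b| := by
        refine Finset.sum_le_sum fun a _ => ?_
        rw [h]
        refine (Finset.abs_sum_le_sum_abs _ _).trans_eq ?_
        simp [abs_mul, abs_of_nonneg (sub_nonneg.2 (hδ _ _))]
    _ = (1 - Fintype.card n * δ) * ∑ a, |y a| := by
        rw [Finset.sum_comm, Finset.mul_sum]
        refine Finset.sum_congr rfl fun b _ => ?_
        rw [← Finset.sum_mul, Finset.sum_sub_distrib, sum_col_of_mem_colStochastic hM]
        simp

theorem IsPrimitive.exists_contraction [Nonempty n] (hp : M.IsPrimitive)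
    (hM : M ∈ colStochastic ℝ n) :
    ∃ (k : ℕ) (c : ℝ), c < 1 ∧ ∀ y : n → ℝ, ∑ a, y a = 0 →
      ∑ a, |(M ^ k *ᵥ y) a| ≤ c * ∑ a, |y a| := by
  obtain ⟨-, k, -, hk⟩ := hp
  obtain ⟨p, hmin⟩ := Finite.exists_min fun p : n × n => (M ^ k) p.1 p.2
  have hcard : (0 : ℝ) < Fintype.card n := Nat.cast_pos.2 Fintype.card_pos
  refine ⟨k, 1 - Fintype.card n * (M ^ k) p.1 p.2,
    sub_lt_self _ (mul_pos hcard (hk _ _)), fun y hy => ?_⟩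
  exact sum_abs_mulVec_le_of_le (pow_mem hM k) (fun a b => hmin (a, b)) hy

theorem IsPrimitive.tendsto_pow_mulVec_zero [Nonempty n] (hp : M.IsPrimitive)
    (hM : M ∈ colStochastic ℝ n) {y : n → ℝ} (hy : ∑ a, y a = 0) :
    Filter.Tendsto (fun k : ℕ => M ^ k *ᵥ y) Filter.atTop (nhds 0) := by
  obtain ⟨K, c, hc, hcontr⟩ := hp.exists_contraction hM
  set s : ℕ → ℝ := fun k => ∑ a, |(M ^ k *ᵥ y) a| with hs
  have hs0 : ∀ k, 0 ≤ s k := fun k => Finset.sum_nonneg fun a _ => abs_nonneg _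
  have hanti : Antitone s := antitone_nat_of_succ_le fun k => by
    simp only [hs, pow_succ', ← mulVec_mulVec]
    exact sum_abs_mulVec_le_of_mem_colStochastic hM _
  have hlim : Filter.Tendsto s Filter.atTop (nhds (⨅ k, s k)) :=
    tendsto_atTop_ciInf hanti ⟨0, by rintro _ ⟨k, rfl⟩; exact hs0 k⟩
  have hstep : ∀ k, s (k + K) ≤ c * s k := fun k => by
    simp only [hs, add_comm k K, pow_add, ← mulVec_mulVec]
    exact hcontr _ ((sum_mulVec_of_mem_colStochastic (pow_mem hM k)).trans hy)
  -- Passing to the limit in `hstep` forces the limit to vanish, since `c < 1`.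
  have hle : ⨅ k, s k ≤ c * ⨅ k, s k :=
    le_of_tendsto_of_tendsto' ((Filter.tendsto_add_atTop_iff_nat K).2 hlim) (hlim.const_mul c) hstep
  have hzero : ⨅ k, s k = 0 := by
    have h0 : 0 ≤ ⨅ k, s k := le_ciInf hs0
    nlinarith
  rw [hzero] at hlim
  refine tendsto_pi_nhds.2 fun a => squeeze_zero_norm (fun k => ?_) hlim
  exact Finset.single_le_sum (f := fun a => |(M ^ k *ᵥ y) a|) (fun _ _ => abs_nonneg _)
    (Finset.mem_univ a)

/-- The all-ones row vector is fixed from the left, so `M - 1` is singular and also has a right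
kernel. -/
theorem exists_ne_zero_mulVec_eq_self [Nonempty n] (hM : M ∈ colStochastic ℝ n) :
    ∃ u ≠ 0, M *ᵥ u = u := by
  have hdet : (M - 1).det = 0 :=
    exists_vecMul_eq_zero_iff.1 ⟨1, one_ne_zero, by rw [vecMul_sub, hM.2, vecMul_one, sub_self]⟩
  obtain ⟨u, hu, hu'⟩ := exists_mulVec_eq_zero_iff.2 hdet
  exact ⟨u, hu, by rwa [sub_mulVec, one_mulVec, sub_eq_zero] at hu'⟩

theorem pow_mulVec_eq_self {u : n → ℝ} (hu : M *ᵥ u = u) (k : ℕ) : M ^ k *ᵥ u = u := by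
  induction k with
  | zero => simp
  | succ k ih => rw [pow_succ, ← mulVec_mulVec, hu, ih]

theorem IsPrimitive.eq_zero_of_mulVec_eq_self [Nonempty n] (hp : M.IsPrimitive)
    (hM : M ∈ colStochastic ℝ n) {u : n → ℝ} (hu : M *ᵥ u = u) (h0 : ∑ a, u a = 0) : u = 0 := by
  have h := hp.tendsto_pow_mulVec_zero hM h0
  simp only [pow_mulVec_eq_self hu] at h
  exact tendsto_nhds_unique tendsto_const_nhds h

/-- Powers of a primitive column-stochastic matrix converge to the projection onto its unique
stationary distribution. -/
theorem IsPrimitive.exists_stationary_tendsto [Nonempty n] (hp : M.IsPrimitive)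
    (hM : M ∈ colStochastic ℝ n) :
    ∃ v : n → ℝ, IsStationaryDistribution M v ∧
      (∀ u : n → ℝ, IsStationaryDistribution M u → u = v) ∧
      ∀ x : n → ℝ, Filter.Tendsto (fun k : ℕ => M ^ k *ᵥ x) Filter.atTop
        (nhds ((∑ a, x a) • v)) := by
  obtain ⟨u, hu, hMu⟩ := exists_ne_zero_mulVec_eq_self hM
  have hsum : ∑ a, u a ≠ 0 := fun h => hu (hp.eq_zero_of_mulVec_eq_self hM hMu h)
  obtain ⟨v, hMv, hv⟩ : ∃ v : n → ℝ, M *ᵥ v = v ∧ ∑ a, v a = 1 :=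
    ⟨(∑ a, u a)⁻¹ • u, by rw [mulVec_smul, hMu], by
      simp [← Finset.mul_sum, inv_mul_cancel₀ hsum]⟩
  have hlim : ∀ x : n → ℝ, Filter.Tendsto (fun k : ℕ => M ^ k *ᵥ x) Filter.atTop
      (nhds ((∑ a, x a) • v)) := fun x => by
    have h0 : ∑ a, (x - (∑ b, x b) • v) a = 0 := by
      simp [Finset.sum_sub_distrib, ← Finset.mul_sum, hv]
    have h := (hp.tendsto_pow_mulVec_zero hM h0).add_const ((∑ b, x b) • v)
    simpa [mulVec_sub, mulVec_smul, pow_mulVec_eq_self hMv] using h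
  refine ⟨v, ⟨fun a => ?_, hv, hMv⟩, fun u hu => ?_, hlim⟩
  · obtain ⟨b⟩ := ‹Nonempty n›
    -- `v` is the limit of the images of a point mass, which are nonnegative.
    have h := hlim (Pi.single b 1)
    rw [Finset.sum_pi_single' b 1 Finset.univ, if_pos (Finset.mem_univ b), one_smul] at h
    refine ge_of_tendsto' (tendsto_pi_nhds.1 h a) fun k => ?_
    exact nonneg_mulVec_of_mem_colStochastic (pow_mem hM k)
      (fun c => by by_cases hc : c = b <;> simp [hc]) a
  · refine sub_eq_zero.1 (hp.eq_zero_of_mulVec_eq_self hM ?_ ?_)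
    · rw [mulVec_sub, hu.fixed, hMv]
    · simp [Finset.sum_sub_distrib, hu.sum_eq_one, hv]

end Convergence

end Matrix

/-! ### The two factorizations for a specialized graph -/

namespace WeightedDigraph

theorem adjMatrix_pos {V : Type*} {G : WeightedDigraph V}
    (hW : ∀ a b, G.Edge a b → G.weight a b ≠ 0) (hA : ∀ a b, 0 ≤ G.adjMatrix a b) {a b : V}
    (h : G.Edge a b) : 0 < G.adjMatrix b a :=
  (hA b a).lt_of_ne' (by simpa [adjMatrix, h] using hW a b h)

variable {V : Type*} [DecidableEq V]

/-- The matrix that distributes the mass at `i` over the two copies of `i`: the share `w` goes to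
the new copy, the share `1 - w` stays. -/
def splitMatrix (i : V) (w : ℝ) : Matrix (Option V) V ℝ
  | some a, b => if a = b then (if b = i then 1 - w else 1) else 0
  | none, b => if b = i then w else 0

/-- The transitions out of the split vertices: the new copy of `i` leads to `j` only, the old copy
follows the remaining edges of `i`. -/
noncomputable def outMatrix (A : Matrix V V ℝ) (i j : V) : Matrix V (Option V) ℝ
  | b, some a => if a = i then (if b = j then 0 else (1 - A j i)⁻¹ * A b i) else A b a
  | b, none => if b = j then 1 else 0

theorem splitMatrix_mul_apply_none [Fintype V] (i : V) (w : ℝ) (P : Matrix V (Option V) ℝ)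
    (a : Option V) : (splitMatrix i w * P) none a = w * P i a := by
  simp [Matrix.mul_apply, splitMatrix]

theorem splitMatrix_mul_apply_some [Fintype V] (i : V) (w : ℝ) (P : Matrix V (Option V) ℝ)
    (b : V) (a : Option V) :
    (splitMatrix i w * P) (some b) a = (if b = i then 1 - w else 1) * P b a := by
  simp only [Matrix.mul_apply, splitMatrix, ite_mul, zero_mul]
  rw [Finset.sum_ite_eq Finset.univ b, if_pos (Finset.mem_univ b)]

theorem splitMatrix_mul_outMatrix [Fintype V] (G : WeightedDigraph V) {i j : V}
    (hij : G.IsSpecializable i j) (hw : G.adjMatrix j i < 1) :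
    splitMatrix i (G.adjMatrix j i) * outMatrix G.adjMatrix i j =
      (G.minimalSpecialization i j).adjMatrix := by
  have hwt : G.adjMatrix j i = G.weight i j := by simp [adjMatrix, hij.edge]
  have hw' : 1 - G.weight i j ≠ 0 := by rw [← hwt]; exact (sub_pos.2 hw).ne'
  have hne := hij.ne
  ext b a
  cases b with
  | none =>
    rw [splitMatrix_mul_apply_none]
    cases a with
    | none => simp [outMatrix, minimalSpecialization, specEdge, adjMatrix, hne]
    | some a =>
      by_cases ha : a = i
      · subst ha
        by_cases he : G.Edge a a <;>
          simp [outMatrix, minimalSpecialization, specEdge, specWeight, adjMatrix, hne, he,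
            hij.edge, mul_assoc]
      · by_cases he : G.Edge a i <;>
          simp [outMatrix, minimalSpecialization, specEdge, specWeight, adjMatrix, ha, he, hij.edge]
  | some b =>
    rw [splitMatrix_mul_apply_some]
    cases a with
    | none =>
      by_cases hb : b = j
      · subst hb
        simp [outMatrix, minimalSpecialization, specEdge, specWeight, adjMatrix,
          hne.symm]
      · simp [outMatrix, minimalSpecialization, specEdge, adjMatrix, hb]
    | some a =>
      by_cases ha : a = i
      · subst ha
        by_cases hb : b = a
        · subst hb
          by_cases he : G.Edge b b <;>
            simp [outMatrix, minimalSpecialization, specEdge, specWeight, adjMatrix, hne, he,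
              hij.edge, hw']
        · by_cases hbj : b = j
          · simp [outMatrix, minimalSpecialization, specEdge, adjMatrix, hbj]
          · by_cases he : G.Edge a b <;>
              simp [outMatrix, minimalSpecialization, specEdge, specWeight, adjMatrix, hb, hbj, he,
                hij.edge]
      · by_cases hb : b = i <;> by_cases he : G.Edge a b <;>
          simp_all [outMatrix, minimalSpecialization, specEdge, specWeight, adjMatrix]

theorem outMatrix_mul_splitMatrix [Fintype V] (A : Matrix V V ℝ) {i j : V} (hw : A j i < 1) :
    outMatrix A i j * splitMatrix i (A j i) = A := by
  have hw' : 1 - A j i ≠ 0 := (sub_pos.2 hw).ne'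
  ext b a
  rw [Matrix.mul_apply, Fintype.sum_option]
  by_cases ha : a = i
  · by_cases hb : b = j
    · simp [outMatrix, splitMatrix, ha, hb]
    · simp [outMatrix, splitMatrix, ha, hb]
      field_simp
  · simp [outMatrix, splitMatrix, ha]

theorem splitMatrix_nonneg {i : V} {w : ℝ} (h0 : 0 ≤ w) (h1 : w ≤ 1) (a : Option V) (b : V) :
    0 ≤ splitMatrix i w a b := by
  have := sub_nonneg.2 h1
  cases a <;> simp only [splitMatrix] <;> split_ifs <;> first | assumption | norm_num

theorem sum_splitMatrix [Fintype V] (i : V) (w : ℝ) (b : V) : ∑ a, splitMatrix i w a b = 1 := by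
  rw [Fintype.sum_option]
  by_cases hb : b = i <;> simp [splitMatrix, hb]

theorem exists_splitMatrix_pos (i : V) {w : ℝ} (h0 : 0 < w) (h1 : w < 1) (a : Option V) :
    ∃ b, 0 < splitMatrix i w a b := by
  cases a with
  | none => exact ⟨i, by simpa [splitMatrix] using h0⟩
  | some a => exact ⟨a, by by_cases ha : a = i <;> simp [splitMatrix, ha, h1]⟩

theorem outMatrix_nonneg {A : Matrix V V ℝ} (hA : ∀ a b, 0 ≤ A a b) {i j : V} (hw : A j i < 1)
    (b : V) (a : Option V) : 0 ≤ outMatrix A i j b a := by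
  have := inv_nonneg.2 (sub_pos.2 hw).le
  cases a <;> simp only [outMatrix] <;> split_ifs <;>
    first | exact hA _ _ | exact mul_nonneg this (hA _ _) | norm_num

theorem sum_outMatrix [Fintype V] {A : Matrix V V ℝ} (hA : ∀ a, ∑ b, A b a = 1) {i j : V}
    (hw : A j i < 1) (a : Option V) : ∑ b, outMatrix A i j b a = 1 := by
  have hw' : 1 - A j i ≠ 0 := (sub_pos.2 hw).ne'
  cases a with
  | none => simp [outMatrix]
  | some a =>
    by_cases ha : a = i
    · have h : ∀ b, outMatrix A i j b (some a) =
          (1 - A j i)⁻¹ * (A b i - if b = j then A j i else 0) := fun b => by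
        by_cases hb : b = j <;> simp [outMatrix, ha, hb]
      simp only [h, ← Finset.mul_sum, Finset.sum_sub_distrib, hA, Finset.sum_ite_eq',
        Finset.mem_univ, if_true, inv_mul_cancel₀ hw']
    · simp [outMatrix, ha, hA]

/-- A second edge out of i carries positive mass in a column of sum 1; this makes (1 - w)⁻¹
meaningful. -/
theorem IsSpecializable.adjMatrix_lt_one [Fintype V] {G : WeightedDigraph V} {i j : V}
    (hij : G.IsSpecializable i j) (hW : ∀ a b, G.Edge a b → G.weight a b ≠ 0)
    (hstoch : G.adjMatrix ∈ Matrix.colStochastic ℝ V) : G.adjMatrix j i < 1 := by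
  obtain ⟨k, hk, hkj⟩ := hij.two_out.exists_ne j
  rw [← Matrix.sum_col_of_mem_colStochastic hstoch i]
  exact Finset.single_lt_sum (f := fun a => G.adjMatrix a i) hkj (Finset.mem_univ j) (Finset.mem_univ k)
    (adjMatrix_pos hW hstoch.1 hk) fun a _ _ => hstoch.1 a i

end WeightedDigraph

theorem mainTheorem1 {V : Type*} [Fintype V] [DecidableEq V] (G : WeightedDigraph V)
    (hW : ∀ a b, G.Edge a b → G.weight a b ≠ 0)
    (hprim : G.adjMatrix.IsPrimitive)
    (hstoch : G.adjMatrix ∈ Matrix.colStochastic ℝ V)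
    (i j : V) (hij : G.IsSpecializable i j) :
    (∀ a b, (G.minimalSpecialization i j).adjMatrix a b ∈ Set.Icc (0 : ℝ) 1) ∧
    (G.minimalSpecialization i j).adjMatrix.IsPrimitive ∧
    (G.minimalSpecialization i j).adjMatrix ∈ Matrix.colStochastic ℝ (Option V) ∧
    ∃ v : Option V → ℝ,
      IsStationaryDistribution (G.minimalSpecialization i j).adjMatrix v ∧
      (∀ u : Option V → ℝ,
        IsStationaryDistribution (G.minimalSpecialization i j).adjMatrix u → u = v) ∧
      ∀ x : Option V → ℝ, (∀ a, 0 ≤ x a) →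
        Filter.Tendsto
          (fun k : ℕ => ((G.minimalSpecialization i j).adjMatrix ^ k).mulVec x)
          Filter.atTop (nhds (‖WithLp.toLp 1 x‖ • v)) := by
  have hw1 := hij.adjMatrix_lt_one hW hstoch
  have hw0 := WeightedDigraph.adjMatrix_pos hW hstoch.1 hij.edge
  have hL := WeightedDigraph.splitMatrix_nonneg (i := i) hw0.le hw1.le
  have hP := WeightedDigraph.outMatrix_nonneg hstoch.1 hw1
  have hsum := WeightedDigraph.sum_outMatrix
    (fun a => Matrix.sum_col_of_mem_colStochastic hstoch a) hw1
  -- A column with no positive entry could not sum to 1.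
  have hpos : ∀ a, ∃ b, 0 < WeightedDigraph.outMatrix G.adjMatrix i j b a := fun a => by
    by_contra! h
    exact absurd (hsum a) (by linarith [Finset.sum_nonpos fun b (_ : b ∈ Finset.univ) => h b])
  have hS : (G.minimalSpecialization i j).adjMatrix ∈ Matrix.colStochastic ℝ (Option V) := by
    rw [← G.splitMatrix_mul_outMatrix hij hw1]
    exact Matrix.mul_mem_colStochastic_of_sum_col hL hP
      (WeightedDigraph.sum_splitMatrix i _) hsum
  have hprim' : (G.minimalSpecialization i j).adjMatrix.IsPrimitive := by
    rw [← G.splitMatrix_mul_outMatrix hij hw1]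
    refine Matrix.IsPrimitive.mul_swap ?_ hL hP
      (WeightedDigraph.exists_splitMatrix_pos i hw0 hw1) hpos
    rwa [WeightedDigraph.outMatrix_mul_splitMatrix _ hw1]
  refine ⟨fun a b => ⟨hS.1 a b, Matrix.le_one_of_mem_colStochastic hS⟩, hprim', hS, ?_⟩
  obtain ⟨v, hv, huniq, hlim⟩ := hprim'.exists_stationary_tendsto hS
  refine ⟨v, hv, huniq, fun x hx => ?_⟩
  have hnorm : ‖WithLp.toLp 1 x‖ = ∑ a, x a := by
    simp [PiLp.norm_eq_of_L1, abs_of_nonneg (hx _)]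
  rw [hnorm]
  exact hlim x
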